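/- **Setting.** Let $Y = X\beta^0+\epsilon$ with $X\in\mathbb R^{n\times p}$ fixed, $n\ge 1$, $(X^TX/n)_{jj}=1$ for all $j$, and $\epsilon\sim\mathcal N(0,\sigma^2 I_n)$, $\sigma>0$. Write $\|a\|_n^2=\frac1n\sum_{i=1}^n a_i^2$, and let $\beta_S\in\mathbb R^p$ be $\beta$ with the coordinates outside $S\subseteq\{1,\dots,p\}$ set to $0$. Let $0<\alpha<1$, $t=\sqrt{\log(4/\alpha)}$, $\Delta=\sqrt{1-2t/\sqrt n}$, where $n$ and $\alpha$ are such that $1-2t/\sqrt n>0$, let $$\lambda=\sqrt{\tfrac2n}\left(\tfrac t\Delta+2+\sqrt{\log p}\right),$$ and let $\hat\beta_{srL}$ be any minimizer of $\beta\mapsto\|Y-X\beta\|_n+\lambda\|\beta\|_1$ over $\mathbb R^p$ (square root LASSO). Let $0\le\delta<1$. **Notation.** Let $\|\cdot\|_1^*$ be the dual norm of $\|\cdot\|_1$ (the maximum norm). Put $$f=\frac{\lambda\|\beta^0\|_1}{\|\epsilon\|_n},\qquad \lambda^0=\frac{\|X^T\epsilon\|_1^*}{n\|\epsilon\|_n},\qquad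 \lambda^m=\lambda^m(S)=\frac{\max\big(\|(X^T\epsilon)_S\|_1^*,\|(X^T\epsilon)_{S^c}\|_1^*\big)}{n\|\epsilon\|_n},$$ $$\lambda^*=\lambda\,\frac{1-\frac{\lambda^0}{\lambda}(1+2f)}{f+2},\qquad \tilde\lambda=\lambda(1+f),\qquad L_S=\frac{\tilde\lambda+\lambda^m}{\lambda^*-\lambda^m}\cdot\frac{1+\delta}{1-\delta},$$ $$\Gamma^2(L,S)=\Big(\min\{\|X\beta_S-X\beta_{S^c}\|_n:\ \|\beta_S\|_1=1,\ \|\beta_{S^c}\|_1\le L\}\Big)^{-2}\in[0,\infty]$$ (with $\min\varnothing=\infty$, $1/0=\infty$, $1/\infty=0$). Let $(\beta_\star,S_\star)$ be any minimizer of $$\|X(\beta-\beta^0)\|_n^2+\|\epsilon\|_n^2\big[(1+\delta)(\tilde\lambda+\lambda^m)\big]^2\,\Gamma^2(L_S,S)$$ over all pairs with $\mathrm{supp}(\beta)\subseteq S\subseteq\{1,\dots,p\}$. **Claim.** There is an event of probability at least $1-\alpha$ on which $\lambda^m(W)\le\lambda$ for every $W\subseteq\{1,\dots,p\}$ and on which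 the following holds for all such $\hat\beta_{srL}$ and $(\beta_\star,S_\star)$. Whenever $C$ is a number with $\lambda^m(S_\star)\le C\lambda$ and $C<\frac1{3(f+1)}$, then $$\|X(\hat\beta_{srL}-\beta^0)\|_n^2\le\|X(\beta_\star-\beta^0)\|_n^2+C_1\lambda^2\,\Gamma^2(L_{S_\star},S_\star),$$ and, if $\delta>0$, $$\|\hat\beta_{srL}-\beta_\star\|_1\le C_2\left(\frac{\|X(\beta_\star-\beta^0)\|_n^2}{\lambda}+C_1\lambda\,\Gamma^2(L_{S_\star},S_\star)\right),$$ where $C_1=(1+\delta)^2\|\epsilon\|_n^2(f+C+1)^2$ and where the second inequality holds - with $C_2=\dfrac1{2\delta\|\epsilon\|_n}\cdot\dfrac1{\frac{1-C(1+2f)}{f+2}-C}$ in all cases, and - also with $C_2=\dfrac1{2\delta\|\epsilon\|_n}\cdot\dfrac1{\sqrt{1-2C(1+2f)}-C}$ if this is well defined and positive, that is, if $1-2C(1+2f)\ge 0$ and $\sqrt{1-2C(1+2f)}>C$. -/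

import Mathlib

open MeasureTheory ProbabilityTheory Matrix
open scoped NNReal ENNReal

noncomputable section

namespace SqrtLasso

variable {n p : ℕ}

/-- The normalized Euclidean norm `‖a‖ₙ`, with `‖a‖ₙ² = (∑ⱼ aⱼ²) / n`. -/
def normN (a : Fin n → ℝ) : ℝ := √((∑ j, a j ^ 2) / n)

/-- The `ℓ₁`-norm on `ℝᵖ`. -/
def l1 (b : Fin p → ℝ) : ℝ := ∑ j, |b j|

/-- The dual norm of the `ℓ₁`-norm. -/
def l1Dual (x : Fin p → ℝ) : ℝ := sSup {r : ℝ | ∃ z : Fin p → ℝ, l1 z ≤ 1 ∧ r = z ⬝ᵥ x}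

/-- The vector `β_S`, viewed in `ℝᵖ`: coordinates outside `S` are set to zero. -/
def restr (S : Finset (Fin p)) (b : Fin p → ℝ) : Fin p → ℝ := fun j => if j ∈ S then b j else 0

/-- `βhat` minimizes `β ↦ ‖Y - Xβ‖ₙ + lam ‖β‖₁`. -/
def IsSqrtLasso (X : Matrix (Fin n) (Fin p) ℝ) (Y : Fin n → ℝ) (lam : ℝ)
    (βhat : Fin p → ℝ) : Prop :=
  ∀ β : Fin p → ℝ, normN (Y - X *ᵥ βhat) + lam * l1 βhat ≤ normN (Y - X *ᵥ β) + lam * l1 β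

/-- `f = lam ‖β⁰‖₁ / ‖ε‖ₙ`. -/
def f (lam : ℝ) (β₀ : Fin p → ℝ) (ε : Fin n → ℝ) : ℝ := lam * l1 β₀ / normN ε

/-- `λ⁰`, the dual norm of `εᵀX`, divided by `n ‖ε‖ₙ`. -/
def lamZero (X : Matrix (Fin n) (Fin p) ℝ) (ε : Fin n → ℝ) : ℝ :=
  l1Dual (ε ᵥ* X) / (n * normN ε)

/-- `λ^S`, the dual norm of `(εᵀX)_S`, divided by `n ‖ε‖ₙ`. -/
def lamOn (X : Matrix (Fin n) (Fin p) ℝ) (ε : Fin n → ℝ) (S : Finset (Fin p)) : ℝ :=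
  l1Dual (restr S (ε ᵥ* X)) / (n * normN ε)

/-- `λᵐ = max(λ^S, λ^{Sᶜ})`. -/
def lamM (X : Matrix (Fin n) (Fin p) ℝ) (ε : Fin n → ℝ) (S : Finset (Fin p)) : ℝ :=
  max (lamOn X ε S) (lamOn X ε Sᶜ)

/-- `λ* = lam (1 - (λ⁰ / lam)(1 + 2f)) / (f + 2)`. -/
def lamStar (X : Matrix (Fin n) (Fin p) ℝ) (β₀ : Fin p → ℝ) (ε : Fin n → ℝ) (lam : ℝ) : ℝ :=
  lam * ((1 - lamZero X ε / lam * (1 + 2 * f lam β₀ ε)) / (f lam β₀ ε + 2))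

/-- `λ̃ = lam (1 + f)`. -/
def lamTilde (β₀ : Fin p → ℝ) (ε : Fin n → ℝ) (lam : ℝ) : ℝ := lam * (1 + f lam β₀ ε)

/-- `L_S = (λ̃ + λᵐ) / (λ* - λᵐ) · (1 + δ) / (1 - δ)`. -/
def LS (X : Matrix (Fin n) (Fin p) ℝ) (β₀ : Fin p → ℝ) (ε : Fin n → ℝ) (lam δ : ℝ)
    (S : Finset (Fin p)) : ℝ :=
  (lamTilde β₀ ε lam + lamM X ε S) / (lamStar X β₀ ε lam - lamM X ε S) * ((1 + δ) / (1 - δ))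

/-- The `ℓ₁`-eigenvalue `δ(L, S) = min {‖Xβ_S - Xβ_{Sᶜ}‖ₙ : ‖β_S‖₁ = 1, ‖β_{Sᶜ}‖₁ ≤ L}`;
the minimum over the empty set (which occurs for `S = ∅`) is `∞`. -/
def eigenvalue (X : Matrix (Fin n) (Fin p) ℝ) (L : ℝ) (S : Finset (Fin p)) : ℝ≥0∞ :=
  ⨅ (β : Fin p → ℝ) (_ : l1 (restr S β) = 1) (_ : l1 (restr Sᶜ β) ≤ L),
    ENNReal.ofReal (normN (X *ᵥ restr S β - X *ᵥ restr Sᶜ β))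

/-- The effective sparsity `Γ²(L, S) = 1 / δ(L, S)²`, with `1 / 0 = ∞` and `1 / ∞ = 0`. -/
def effSparsity (X : Matrix (Fin n) (Fin p) ℝ) (L : ℝ) (S : Finset (Fin p)) : ℝ≥0∞ :=
  (eigenvalue X L S ^ 2)⁻¹

/-- The oracle bound
`‖X(β - β⁰)‖ₙ² + ‖ε‖ₙ² [(1 + δ)(λ̃ + λᵐ)]² Γ²(L_S, S)` at `β` and `S`. -/
def oracleBound (X : Matrix (Fin n) (Fin p) ℝ) (β₀ : Fin p → ℝ) (ε : Fin n → ℝ) (lam δ : ℝ)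
    (β : Fin p → ℝ) (S : Finset (Fin p)) : ℝ≥0∞ :=
  ENNReal.ofReal (normN (X *ᵥ (β - β₀)) ^ 2) +
    ENNReal.ofReal (normN ε ^ 2 * ((1 + δ) * (lamTilde β₀ ε lam + lamM X ε S)) ^ 2) *
      effSparsity X (LS X β₀ ε lam δ S) S

/-- `(β⋆, S⋆)` minimizes the oracle bound over all pairs `(β, S)` with `supp β ⊆ S`. -/
def IsOracle (X : Matrix (Fin n) (Fin p) ℝ) (β₀ : Fin p → ℝ) (ε : Fin n → ℝ) (lam δ : ℝ)
    (βs : Fin p → ℝ) (Ss : Finset (Fin p)) : Prop :=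
  (∀ j, βs j ≠ 0 → j ∈ Ss) ∧
    ∀ (S : Finset (Fin p)) (β : Fin p → ℝ), (∀ j, β j ≠ 0 → j ∈ S) →
      oracleBound X β₀ ε lam δ βs Ss ≤ oracleBound X β₀ ε lam δ β S

/-- `C₁ = (1 + δ)² ‖ε‖ₙ² (f + C + 1)²`. -/
def C₁ (β₀ : Fin p → ℝ) (ε : Fin n → ℝ) (lam δ C : ℝ) : ℝ :=
  (1 + δ) ^ 2 * normN ε ^ 2 * (f lam β₀ ε + C + 1) ^ 2

/-- `C₂ = 1 / (2 δ ‖ε‖ₙ) · 1 / (√(1 - 2C(1 + 2f)) - C)`; it is used only where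
`C < √(1 - 2C(1 + 2f))`. -/
def C₂ (β₀ : Fin p → ℝ) (ε : Fin n → ℝ) (lam δ C : ℝ) : ℝ :=
  1 / (2 * δ * normN ε) * (1 / (√(1 - 2 * C * (1 + 2 * f lam β₀ ε)) - C))

/-- `C₂' = 1 / (2 δ ‖ε‖ₙ) · 1 / ((1 - C(1 + 2f)) / (f + 2) - C)`, the value which `λ*` gives;
it is positive whenever `C < 1 / (3 (1 + f))`. -/
def C₂' (β₀ : Fin p → ℝ) (ε : Fin n → ℝ) (lam δ C : ℝ) : ℝ :=
  1 / (2 * δ * normN ε) *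
    (1 / ((1 - C * (1 + 2 * f lam β₀ ε)) / (f lam β₀ ε + 2) - C))

/-- The estimation bound `‖β̂ - β⋆‖₁ ≤ K (‖X(β⋆ - β⁰)‖ₙ² / lam + C₁ lam Γ²(L_{S⋆}, S⋆))`. -/
def EstimationBound (X : Matrix (Fin n) (Fin p) ℝ) (β₀ : Fin p → ℝ) (ε : Fin n → ℝ)
    (lam δ C K : ℝ) (βhat βs : Fin p → ℝ) (Ss : Finset (Fin p)) : Prop :=
  ENNReal.ofReal (l1 (βhat - βs)) ≤
    ENNReal.ofReal K * (ENNReal.ofReal (normN (X *ᵥ (βs - β₀)) ^ 2 / lam) +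
      ENNReal.ofReal (C₁ β₀ ε lam δ C * lam) * effSparsity X (LS X β₀ ε lam δ Ss) Ss)

/-- The prediction bound
`‖X(β̂ - β⁰)‖ₙ² ≤ ‖X(β⋆ - β⁰)‖ₙ² + C₁ lam² Γ²(L_{S⋆}, S⋆)`. -/
def PredictionBound (X : Matrix (Fin n) (Fin p) ℝ) (β₀ : Fin p → ℝ) (ε : Fin n → ℝ)
    (lam δ C : ℝ) (βhat βs : Fin p → ℝ) (Ss : Finset (Fin p)) : Prop :=
  ENNReal.ofReal (normN (X *ᵥ (βhat - β₀)) ^ 2) ≤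
    ENNReal.ofReal (normN (X *ᵥ (βs - β₀)) ^ 2) +
      ENNReal.ofReal (C₁ β₀ ε lam δ C * lam ^ 2) * effSparsity X (LS X β₀ ε lam δ Ss) Ss

end SqrtLasso

end

/-! Probability enters only once: with probability at least 1 - α, ε ≠ 0 and every |(εᵀX)_j| is at
most lam n ‖ε‖ₙ. The ratio |(εᵀX)_j| / (n ‖ε‖ₙ) is the cosine of the angle between a Gaussian vector
and a fixed line, so σ cancels; a Chernoff bound (`measure_normSq_lt_inner_sq_le`) and a union bound
over the columns suffice.

The rest is deterministic, given ε ≠ 0. First-order optimality (`IsSqrtLasso.dotProduct_le`) is that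
of a LASSO with penalty lam N, where N is the norm of the residual, so N has to be controlled from
both sides. Comparison with β⁰ gives N ≤ ‖ε‖ₙ(1 + f) and bounds ‖β̂ - β⁰‖₁, hence the noise term,
hence N from below.

`IsSqrtLasso.oracle_inequality` then treats any β supported in S. Let I be the normalized inner
product of X(β̂ - β⁰) and X(β̂ - β). Either I is so negative that expanding a square suffices, or β̂
- β lies in the cone behind Γ²(L_S, S) and 2xy - y² ≤ x² finishes. The slack δ pays for the ℓ₁
error. -/

namespace SqrtLasso

/-! ### Gaussian tail bound for the angle with a fixed line -/

/-- Exponential-quadratic moments of the standard normal distribution. -/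
lemma lintegral_exp_linear_sub_sq_gaussianReal (b : ℝ) {κ : ℝ} (hκ : 0 < 1 + 2 * κ) :
    ∫⁻ x, ENNReal.ofReal (Real.exp (b * x - κ * x ^ 2)) ∂(gaussianReal 0 1) =
      ENNReal.ofReal (√(1 / (1 + 2 * κ)) * Real.exp (b ^ 2 / (2 * (1 + 2 * κ)))) := by
  -- Completing the square: the tilted density is a multiple of the Gaussian density with variance w
  -- and mean b w.
  obtain ⟨w, hw⟩ : ∃ w : ℝ≥0, (w : ℝ) = 1 / (1 + 2 * κ) := ⟨⟨1 / (1 + 2 * κ), by positivity⟩, rfl⟩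
  have hw0 : (0 : ℝ) < w := by rw [hw]; positivity
  have hwne : w ≠ 0 := by rintro rfl; simp at hw0
  have hκw : κ = (1 / w - 1) / 2 := by rw [hw]; field_simp; ring
  rw [gaussianReal_of_var_ne_zero 0 one_ne_zero,
    lintegral_withDensity_eq_lintegral_mul _ (measurable_gaussianPDF _ _) (by fun_prop)]
  have key : ∀ x : ℝ, (gaussianPDF 0 1 * fun x => ENNReal.ofReal (Real.exp (b * x - κ * x ^ 2))) x =
      ENNReal.ofReal (√(1 / (1 + 2 * κ)) * Real.exp (b ^ 2 / (2 * (1 + 2 * κ)))) *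
        gaussianPDF (b * w) w x := by
    intro x
    simp only [Pi.mul_apply, gaussianPDF]
    rw [← ENNReal.ofReal_mul (gaussianPDFReal_nonneg _ _ _), ← ENNReal.ofReal_mul (by positivity)]
    congr 1
    have h1 : b ^ 2 / (2 * (1 + 2 * κ)) = b ^ 2 * w / 2 := by rw [hw]; field_simp
    rw [← hw, h1]
    simp only [gaussianPDFReal, NNReal.coe_one, mul_one, sub_zero]
    rw [Real.sqrt_mul (by positivity) (w : ℝ), mul_inv]
    have h2 : √(w : ℝ) ≠ 0 := by positivity
    rw [mul_assoc, ← Real.exp_add]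
    have h3 : -x ^ 2 / 2 + (b * x - κ * x ^ 2) =
        b ^ 2 * w / 2 + -(x - b * w) ^ 2 / (2 * w) := by
      rw [hκw]; field_simp; ring
    rw [h3, Real.exp_add]
    field_simp
  simp_rw [key]
  rw [lintegral_const_mul _ (measurable_gaussianPDF _ _), lintegral_gaussianPDF_eq_one _ hwne,
    mul_one]

/-- For a unit vector `v`, the moment generating function of
`⟨v, Z⟩² - q ‖Z‖²` at `m / 2`, where `Z` is a standard normal vector. -/
lemma lintegral_exp_inner_sq_sub_normSq {Ω ι : Type*} [MeasurableSpace Ω] [Fintype ι]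
    {P : Measure Ω} [IsProbabilityMeasure P] {Z : ι → Ω → ℝ}
    (hZm : ∀ i, Measurable (Z i)) (hindep : iIndepFun Z P)
    (hlaw : ∀ i, HasLaw (Z i) (gaussianReal 0 1) P)
    {v : ι → ℝ} (hv : ∑ i, v i ^ 2 = 1) {m q : ℝ} (hm : 0 ≤ m) (hq : 0 ≤ q)
    (hmq : m < 1 + m * q) :
    ∫⁻ ω, ENNReal.ofReal (Real.exp (m / 2 * ((∑ i, v i * Z i ω) ^ 2 - q * ∑ i, Z i ω ^ 2))) ∂P =
      ENNReal.ofReal (√(1 / (1 + m * q)) ^ Fintype.card ι * √(1 / (1 - m / (1 + m * q)))) := by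
  have hpos : 0 < 1 + m * q := by positivity
  set G : Measure ℝ := gaussianReal 0 1 with hG
  -- The square is linearized by an auxiliary standard normal g: exp(m s² / 2) is the mean of exp(√m
  -- s g). The integrand then factors over the coordinates.
  have step : ∀ ω, ENNReal.ofReal
        (Real.exp (m / 2 * ((∑ i, v i * Z i ω) ^ 2 - q * ∑ i, Z i ω ^ 2))) =
      ∫⁻ g, ∏ i, ENNReal.ofReal (Real.exp (√m * g * v i * Z i ω - m * q / 2 * Z i ω ^ 2)) ∂G := by
    intro ω
    have h1 : ∀ g : ℝ, ∏ i, ENNReal.ofReal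
          (Real.exp (√m * g * v i * Z i ω - m * q / 2 * Z i ω ^ 2)) =
        ENNReal.ofReal (Real.exp (-(m * q / 2 * ∑ i, Z i ω ^ 2))) *
          ENNReal.ofReal (Real.exp (√m * (∑ i, v i * Z i ω) * g - 0 * g ^ 2)) := by
      intro g
      rw [← ENNReal.ofReal_prod_of_nonneg (fun i _ => (Real.exp_pos _).le), ← Real.exp_sum,
        ← ENNReal.ofReal_mul (Real.exp_pos _).le, ← Real.exp_add]
      congr 2
      rw [Finset.sum_sub_distrib, Finset.mul_sum, Finset.mul_sum, Finset.sum_mul]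
      rw [zero_mul, sub_zero, sub_eq_neg_add]
      congr 1
      exact Finset.sum_congr rfl fun i _ => by ring
    simp_rw [h1]
    rw [lintegral_const_mul _ (by fun_prop), lintegral_exp_linear_sub_sq_gaussianReal _ (by norm_num),
      ← ENNReal.ofReal_mul (Real.exp_pos _).le]
    congr 1
    simp only [mul_zero, add_zero, div_one, Real.sqrt_one, one_mul, mul_one]
    rw [← Real.exp_add, mul_pow, Real.sq_sqrt hm]
    congr 1
    ring
  simp_rw [step]
  rw [lintegral_lintegral_swap]
  -- For fixed g the coordinates are independent, and ∑ vᵢ² = 1 merges their factors into one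
  -- Gaussian exponential in g, integrable because m < 1 + mq.
  · have h2 : ∀ g : ℝ, ∫⁻ ω, ∏ i, ENNReal.ofReal
          (Real.exp (√m * g * v i * Z i ω - m * q / 2 * Z i ω ^ 2)) ∂P =
        ENNReal.ofReal (√(1 / (1 + m * q)) ^ Fintype.card ι) *
          ENNReal.ofReal (Real.exp (0 * g - -(m / (2 * (1 + m * q))) * g ^ 2)) := by
      intro g
      rw [lintegral_prod_eq_prod_lintegral_of_indepFun Finset.univ
        (fun i ω => ENNReal.ofReal (Real.exp (√m * g * v i * Z i ω - m * q / 2 * Z i ω ^ 2)))]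
      · have h3 : ∀ i, ∫⁻ ω, ENNReal.ofReal
              (Real.exp (√m * g * v i * Z i ω - m * q / 2 * Z i ω ^ 2)) ∂P =
            ENNReal.ofReal (√(1 / (1 + m * q)) *
              Real.exp (m * g ^ 2 / (2 * (1 + m * q)) * v i ^ 2)) := by
          intro i
          rw [(hlaw i).lintegral_comp (f := fun x => ENNReal.ofReal
            (Real.exp (√m * g * v i * x - m * q / 2 * x ^ 2))) (by fun_prop),
            lintegral_exp_linear_sub_sq_gaussianReal _ (by linarith)]
          have : 1 + 2 * (m * q / 2) = 1 + m * q := by ring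
          rw [this, mul_pow, mul_pow, Real.sq_sqrt hm]
          congr 3
          ring
        simp_rw [h3]
        rw [← ENNReal.ofReal_prod_of_nonneg (fun i _ => by positivity), Finset.prod_mul_distrib,
          ← Real.exp_sum, ← Finset.mul_sum, hv, ← ENNReal.ofReal_mul (by positivity),
          Finset.prod_const, Finset.card_univ]
        congr 3
        field_simp
        ring
      · exact hindep.comp (fun i x => ENNReal.ofReal
          (Real.exp (√m * g * v i * x - m * q / 2 * x ^ 2))) (fun i => by fun_prop)
      · intro i
        have := hZm i
        fun_prop
    simp_rw [h2]
    have h4 : 0 < 1 - m / (1 + m * q) := by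
      rw [sub_pos, div_lt_one hpos]; exact hmq
    have h5 : 1 + 2 * -(m / (2 * (1 + m * q))) = 1 - m / (1 + m * q) := by field_simp; ring
    rw [lintegral_const_mul _ (by fun_prop),
      lintegral_exp_linear_sub_sq_gaussianReal _ (by rw [h5]; exact h4), h5,
      ← ENNReal.ofReal_mul (by positivity)]
    simp
  · refine Finset.aemeasurable_fun_prod _ fun i _ => ?_
    have := hZm i
    fun_prop

/-- A choice of the exponent in the Chernoff bound for spherical caps. -/
lemma exists_chernoff_exponent {n : ℕ} (hn : 0 < n) {T : ℝ} (hT : 1 ≤ T) {q : ℝ}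
    (hq : q = 2 * T ^ 2 / n) (hq1 : q < 1) :
    ∃ m : ℝ, 0 < m ∧ m < 1 + m * q ∧
      √(1 / (1 + m * q)) ^ n * √(1 / (1 - m / (1 + m * q))) ≤ √2 * T * Real.exp (1 - T ^ 2) := by
  have hn' : (0 : ℝ) < n := by exact_mod_cast hn
  have hT0 : 0 < T := by linarith
  have hq0 : 0 < q := by rw [hq]; positivity
  have hqn : q * n = 2 * T ^ 2 := by rw [hq]; field_simp
  -- With m = (1 - η)/(1 - q), the constraint m < 1 + mq says η > 0. The choice η = 1/(2T²) makes η
  -- q n = 1, so it costs only a constant factor in the exponential.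
  obtain ⟨η, hη⟩ : ∃ η : ℝ, η = 1 / (2 * T ^ 2) := ⟨_, rfl⟩
  have hη0 : 0 < η := by rw [hη]; positivity
  have hηT : η * (2 * T ^ 2) = 1 := by rw [hη]; field_simp
  have hη1 : η < 1 := by
    rw [hη, div_lt_one (by positivity)]; nlinarith
  have h1q : 0 < 1 - q := by linarith
  have hηq : η * q < q := by nlinarith
  have h1ηq : 0 < 1 - η * q := by linarith
  obtain ⟨a, ha⟩ : ∃ a : ℝ, a = (1 - q) / (1 - η * q) := ⟨_, rfl⟩
  have ha0 : 0 < a := by rw [ha]; positivity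
  have hw : 1 + (1 - η) / (1 - q) * q = (1 - η * q) / (1 - q) := by field_simp; ring
  have hm0 : 0 < (1 - η) / (1 - q) := div_pos (by linarith) h1q
  refine ⟨(1 - η) / (1 - q), hm0, ?_, ?_⟩
  · rw [hw]
    gcongr
    nlinarith
  · have e1 : 1 / (1 + (1 - η) / (1 - q) * q) = a := by rw [hw, ha, one_div_div]
    have e2 : 1 - (1 - η) / (1 - q) / (1 + (1 - η) / (1 - q) * q) = η * a := by
      rw [hw, ha]; field_simp; ring
    rw [e1, e2]
    -- The factor 1/√(ηa) uses up one power of a under the root, hence the exponent n - 1; the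
    -- resulting loss is absorbed by (1 - η)q ≤ 1.
    have hsq : (√a ^ n * √(1 / (η * a))) ^ 2 = a ^ (n - 1) * (2 * T ^ 2) := by
      rw [mul_pow, ← pow_mul, mul_comm n 2, pow_mul, Real.sq_sqrt ha0.le,
        Real.sq_sqrt (by positivity)]
      obtain ⟨k, rfl⟩ : ∃ k, n = k + 1 := ⟨n - 1, by omega⟩
      have : 1 / (η * a) = 2 * T ^ 2 / a := by rw [hη]; field_simp
      rw [this, Nat.add_sub_cancel, pow_succ]
      field_simp
    have hale : a ≤ Real.exp (-((1 - η) * q)) := by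
      refine le_trans ?_ (Real.add_one_le_exp _)
      rw [ha, div_le_iff₀ h1ηq]
      have : 0 ≤ η * q * ((1 - η) * q) := by
        have : 0 ≤ 1 - η := by linarith
        positivity
      nlinarith
    have hapow : a ^ (n - 1) ≤ Real.exp (2 * (1 - T ^ 2)) := by
      refine (pow_le_pow_left₀ ha0.le hale _).trans ?_
      rw [← Real.exp_nat_mul, Real.exp_le_exp, Nat.cast_sub hn, Nat.cast_one]
      have : ((n : ℝ) - 1) * -((1 - η) * q) = -(q * n) + η * (q * n) + (1 - η) * q := by ring
      rw [this, hqn, hηT]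
      nlinarith
    refine (sq_le_sq₀ (by positivity) (by positivity)).1 ?_
    rw [hsq, mul_pow, mul_pow, Real.sq_sqrt (by norm_num), ← Real.exp_nat_mul]
    push_cast
    rw [mul_comm]
    gcongr

/-- A Gaussian vector is unlikely to make a small angle with a fixed line. -/
lemma measure_normSq_lt_inner_sq_le {Ω : Type*} [MeasurableSpace Ω]
    {P : Measure Ω} [IsProbabilityMeasure P] {n : ℕ} (hn : 0 < n) {Z : Fin n → Ω → ℝ}
    (hindep : iIndepFun Z P) (hlaw : ∀ i, HasLaw (Z i) (gaussianReal 0 1) P)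
    {v : Fin n → ℝ} (hv : ∑ i, v i ^ 2 = 1) {T : ℝ} (hT : 1 ≤ T) :
    P {ω | 2 * T ^ 2 / n * ∑ i, Z i ω ^ 2 < (∑ i, v i * Z i ω) ^ 2} ≤
      ENNReal.ofReal (√2 * T * Real.exp (1 - T ^ 2)) := by
  wlog hZm : ∀ i, Measurable (Z i) generalizing Z
  · have hae : ∀ i, Z i =ᵐ[P] (hlaw i).aemeasurable.mk := fun i => (hlaw i).aemeasurable.ae_eq_mk
    have := this (hindep.congr hae) (fun i => (hlaw i).congr (hae i).symm)
      (fun i => (hlaw i).aemeasurable.measurable_mk)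
    refine le_trans (measure_mono_ae ?_) this
    filter_upwards [ae_all_iff.2 hae] with ω hω h
    change _ < _ at h
    change _ < _
    simpa only [← hω] using h
  rcases lt_or_ge (2 * T ^ 2 / (n : ℝ)) 1 with hq1 | hq1
  · obtain ⟨m, hm0, hmq, hb⟩ := exists_chernoff_exponent hn hT rfl hq1
    refine le_trans ?_ (ENNReal.ofReal_le_ofReal hb)
    have := lintegral_exp_inner_sq_sub_normSq hZm hindep hlaw hv hm0.le
      (by positivity : 0 ≤ 2 * T ^ 2 / (n : ℝ)) hmq
    rw [Fintype.card_fin] at this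
    rw [← this]
    refine le_trans (measure_mono ?_) (le_of_eq_of_le (one_mul _).symm
      (mul_meas_ge_le_lintegral (by fun_prop) 1))
    intro ω hω
    simp only [Set.mem_ofPred_eq] at hω ⊢
    rw [ENNReal.one_le_ofReal, Real.one_le_exp_iff]
    exact mul_nonneg (by positivity) (sub_nonneg.2 hω.le)
  -- For q ≥ 1 the event is empty by Cauchy–Schwarz.
  · have : {ω | 2 * T ^ 2 / n * ∑ i, Z i ω ^ 2 < (∑ i, v i * Z i ω) ^ 2} = ∅ := by
      refine Set.eq_empty_of_forall_notMem fun ω hω => ?_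
      have h1 := Finset.sum_mul_sq_le_sq_mul_sq Finset.univ v (fun i => Z i ω)
      have h2 : 0 ≤ ∑ i, Z i ω ^ 2 := Finset.sum_nonneg fun i _ => sq_nonneg _
      simp only [Set.mem_ofPred_eq] at hω
      rw [hv] at h1
      nlinarith
    simp [this]

/-- Since √2 ≤ e and T ≤ exp(T - 1), the left side is at most exp(1 + T - T²); the summand 2 in T ≥
t + 2 + ℓ absorbs the lower-order terms. -/
lemma tail_le_exp {t ℓ T : ℝ} (ht : 0 ≤ t) (hℓ : 0 ≤ ℓ) (hT : t + 2 + ℓ ≤ T) :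
    √2 * T * Real.exp (1 - T ^ 2) ≤ Real.exp (-t ^ 2) * Real.exp (-ℓ ^ 2) := by
  have h1 : T ≤ Real.exp (T - 1) := by linarith [Real.add_one_le_exp (T - 1)]
  have h2 : √2 ≤ Real.exp 1 := by
    have : √2 ≤ 2 := Real.sqrt_le_iff.2 ⟨by norm_num, by norm_num⟩
    linarith [Real.add_one_le_exp 1]
  have hT0 : 0 ≤ T := by linarith
  calc √2 * T * Real.exp (1 - T ^ 2)
      ≤ Real.exp 1 * Real.exp (T - 1) * Real.exp (1 - T ^ 2) := by gcongr
    _ = Real.exp (1 + T - T ^ 2) := by rw [← Real.exp_add, ← Real.exp_add]; congr 1; ring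
    _ ≤ Real.exp (-t ^ 2 + -ℓ ^ 2) := by
      rw [Real.exp_le_exp]
      nlinarith [mul_nonneg ht hℓ, mul_nonneg (sub_nonneg.2 hT) hT0,
        mul_nonneg (sub_nonneg.2 hT) (by linarith : 0 ≤ t + 2 + ℓ)]
    _ = _ := Real.exp_add _ _

/-! ### The high-probability event -/

lemma normN_sq {n : ℕ} (a : Fin n → ℝ) : normN a ^ 2 = (∑ j, a j ^ 2) / n :=
  Real.sq_sqrt (by positivity)

lemma normN_nonneg {n : ℕ} (a : Fin n → ℝ) : 0 ≤ normN a := Real.sqrt_nonneg _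

/-- With probability at least `1 - α`, the noise is nonzero and its correlation with every column
of the design is at most `lam`. -/
lemma exists_event_abs_vecMul_le {Ω : Type*} [MeasurableSpace Ω] (P : Measure Ω)
    [IsProbabilityMeasure P] {n p : ℕ} (hn : 0 < n)
    (X : Matrix (Fin n) (Fin p) ℝ) (hX : ∀ j, (Xᵀ * X) j j / (n : ℝ) = 1)
    (σ : ℝ≥0) (hσ : 0 < σ) (ε : Ω → Fin n → ℝ)
    (hindep : iIndepFun (fun (i : Fin n) (ω : Ω) => ε ω i) P)
    (hlaw : ∀ i, HasLaw (fun ω => ε ω i) (gaussianReal 0 (σ ^ 2)) P)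
    {α t T lam : ℝ} (hα0 : 0 < α) (hα1 : α < 1) (ht : t = √(Real.log (4 / α)))
    (hT : t + 2 + √(Real.log (p : ℝ)) ≤ T) (hlam : lam = √(2 / (n : ℝ)) * T) :
    ∃ A : Set Ω, MeasurableSet A ∧ ENNReal.ofReal (1 - α) ≤ P A ∧ ∀ ω ∈ A,
      0 < normN (ε ω) ∧ ∀ j, |(ε ω ᵥ* X) j| ≤ lam * (n * normN (ε ω)) := by
  have hn' : (0 : ℝ) < n := by exact_mod_cast hn
  have hσ' : (0 : ℝ) < σ := by exact_mod_cast hσ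
  have ht0 : 0 ≤ t := by rw [ht]; positivity
  have hT1 : 1 ≤ T := by linarith [Real.sqrt_nonneg (Real.log (p : ℝ))]
  have hlam0 : 0 ≤ lam := by rw [hlam]; positivity
  have hlam2 : lam ^ 2 = 2 * T ^ 2 / n := by
    rw [hlam, mul_pow, Real.sq_sqrt (by positivity)]; ring
  have het : Real.exp (-t ^ 2) = α / 4 := by
    rw [ht, Real.sq_sqrt, Real.exp_neg, Real.exp_log (by positivity), inv_div]
    exact Real.log_nonneg (by rw [le_div_iff₀ hα0]; linarith)
  have hlawZ : ∀ i, HasLaw (fun ω => ε ω i / σ) (gaussianReal 0 1) P := by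
    intro i
    have := gaussianReal_div_const (hlaw i) (σ : ℝ)
    convert this using 2
    · simp
    · ext
      have : (σ : ℝ) ≠ 0 := hσ'.ne'
      simp [this]
  have hindepZ : iIndepFun (fun i ω => ε ω i / σ) P :=
    hindep.comp (fun _ x => x / (σ : ℝ)) (fun _ => by fun_prop)
  set B : Fin p → Set Ω := fun j => {ω | lam * (n * normN (ε ω)) < |(ε ω ᵥ* X) j|} with hB
  set B₀ : Set Ω := {ω | ε ω ⟨0, hn⟩ = 0} with hB₀
  have hPB₀ : P B₀ = 0 := by
    have h1 := (hlaw ⟨0, hn⟩).measure_eq (p := fun x => x = 0) (measurableSet_singleton 0)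
    have : NullSingletonClass (gaussianReal 0 (σ ^ 2)) :=
      nullSingletonClass_gaussianReal (by positivity)
    rw [hB₀, h1]
    exact measure_singleton 0
  have hPB : ∀ j, P (B j) ≤ ENNReal.ofReal (α / p) := by
    intro j
    have hp : (0 : ℝ) < p := by exact_mod_cast (Fin.pos j)
    have hp1 : (1 : ℝ) ≤ p := by exact_mod_cast (Fin.pos j)
    have hXj : ∑ i, X i j ^ 2 = n := by
      have := hX j
      rw [div_eq_one_iff_eq hn'.ne', Matrix.mul_apply] at this
      rw [← this]
      exact Finset.sum_congr rfl fun i _ => by rw [Matrix.transpose_apply, sq]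
    have hv : ∑ i, (X i j / √(n : ℝ)) ^ 2 = 1 := by
      simp_rw [div_pow, Real.sq_sqrt hn'.le]
      rw [← Finset.sum_div, hXj, div_self hn'.ne']
    have htail := measure_normSq_lt_inner_sq_le hn hindepZ hlawZ hv hT1
    have hexp : √2 * T * Real.exp (1 - T ^ 2) ≤ α / p := by
      refine (tail_le_exp ht0 (Real.sqrt_nonneg _) hT).trans ?_
      rw [het, Real.sq_sqrt (Real.log_nonneg hp1), Real.exp_neg, Real.exp_log hp, ← div_eq_mul_inv]
      gcongr
      linarith
    refine (measure_mono ?_).trans (htail.trans (ENNReal.ofReal_le_ofReal hexp))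
    intro ω hω
    simp only [hB, Set.mem_ofPred_eq] at hω ⊢
    have h2 := pow_lt_pow_left₀ hω
      (mul_nonneg hlam0 (mul_nonneg hn'.le (normN_nonneg _))) two_ne_zero
    rw [sq_abs, mul_pow, mul_pow, normN_sq, hlam2] at h2
    have e1 : ∑ i, X i j / √(n : ℝ) * (ε ω i / σ) = (ε ω ᵥ* X) j / (√(n : ℝ) * σ) := by
      rw [Matrix.vecMul, dotProduct, Finset.sum_div]
      exact Finset.sum_congr rfl fun i _ => by field_simp
    simp_rw [e1, div_pow, mul_pow, Real.sq_sqrt hn'.le]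
    rw [← Finset.sum_div, lt_div_iff₀ (by positivity)]
    refine lt_of_eq_of_lt ?_ h2
    field_simp
  -- The coordinates of ε are only a.e. measurable, so the bad set is replaced by a measurable hull
  -- of the same measure.
  refine ⟨(toMeasurable P (B₀ ∪ ⋃ j, B j))ᶜ, (measurableSet_toMeasurable _ _).compl, ?_, ?_⟩
  · rw [measure_compl (measurableSet_toMeasurable _ _) (measure_ne_top _ _), measure_univ,
      measure_toMeasurable, ENNReal.ofReal_sub _ hα0.le, ENNReal.ofReal_one]
    refine tsub_le_tsub_left ?_ _
    refine (measure_union_le _ _).trans ?_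
    rw [hPB₀, zero_add]
    refine (measure_iUnion_fintype_le _ _).trans ((Finset.sum_le_sum fun j _ => hPB j).trans ?_)
    rw [Finset.sum_const, Finset.card_univ, Fintype.card_fin, nsmul_eq_mul,
      ← ENNReal.ofReal_natCast, ← ENNReal.ofReal_mul (by positivity)]
    refine ENNReal.ofReal_le_ofReal ?_
    rcases Nat.eq_zero_or_pos p with rfl | hp
    · simpa using hα0.le
    · have : (p : ℝ) ≠ 0 := by exact_mod_cast hp.ne'
      rw [mul_div_cancel₀ _ this]
  · intro ω hω
    have hω' : ω ∉ B₀ ∪ ⋃ j, B j := fun h => hω (subset_toMeasurable _ _ h)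
    simp only [Set.mem_union, Set.mem_iUnion, not_or, not_exists] at hω'
    refine ⟨?_, fun j => not_lt.1 (hω'.2 j)⟩
    refine Real.sqrt_pos.2 (div_pos ?_ hn')
    refine Finset.sum_pos' (fun i _ => sq_nonneg _) ⟨⟨0, hn⟩, Finset.mem_univ _, ?_⟩
    exact sq_pos_of_ne_zero hω'.1

/-! ### Norms and duality -/

lemma normN_sq_eq_dotProduct {n : ℕ} (a : Fin n → ℝ) : normN a ^ 2 = a ⬝ᵥ a / n := by
  rw [normN_sq, dotProduct]
  simp_rw [sq]

lemma normN_smul {n : ℕ} (c : ℝ) (a : Fin n → ℝ) : normN (c • a) = |c| * normN a := by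
  simp only [normN, Pi.smul_apply, smul_eq_mul, mul_pow]
  rw [← Finset.mul_sum, mul_div_assoc, Real.sqrt_mul (sq_nonneg c), Real.sqrt_sq_eq_abs]

lemma dotProduct_div_le_normN_mul {n : ℕ} (a b : Fin n → ℝ) :
    a ⬝ᵥ b / n ≤ normN a * normN b := by
  refine Real.le_sqrt_of_sq_le ?_ |>.trans_eq (Real.sqrt_mul (by positivity) _)
  rw [div_pow, div_mul_div_comm, ← sq]
  gcongr
  exact Finset.sum_mul_sq_le_sq_mul_sq _ _ _

lemma l1_nonneg {p : ℕ} (b : Fin p → ℝ) : 0 ≤ l1 b := Finset.sum_nonneg fun _ _ => abs_nonneg _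

lemma l1_sub_le {p : ℕ} (a b : Fin p → ℝ) : l1 (a - b) ≤ l1 a + l1 b := by
  rw [l1, l1, l1, ← Finset.sum_add_distrib]
  exact Finset.sum_le_sum fun j _ => abs_sub _ _

lemma l1_smul {p : ℕ} (c : ℝ) (b : Fin p → ℝ) : l1 (c • b) = |c| * l1 b := by
  simp [l1, abs_mul, Finset.mul_sum]

lemma l1_restr_add_l1_restr_compl {p : ℕ} (S : Finset (Fin p)) (b : Fin p → ℝ) :
    l1 (restr S b) + l1 (restr Sᶜ b) = l1 b := by
  rw [l1, l1, l1, ← Finset.sum_add_distrib]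
  refine Finset.sum_congr rfl fun j _ => ?_
  by_cases hj : j ∈ S <;> simp [restr, hj]

lemma abs_dotProduct_le_mul_l1 {p : ℕ} {x : Fin p → ℝ} {c : ℝ} (hx : ∀ j, |x j| ≤ c)
    (z : Fin p → ℝ) : |z ⬝ᵥ x| ≤ c * l1 z := by
  rw [dotProduct, l1, Finset.mul_sum]
  refine (Finset.abs_sum_le_sum_abs _ _).trans (Finset.sum_le_sum fun j _ => ?_)
  rw [abs_mul, mul_comm]
  exact mul_le_mul_of_nonneg_right (hx j) (abs_nonneg _)

lemma l1Dual_le {p : ℕ} {x : Fin p → ℝ} {c : ℝ} (hc : 0 ≤ c) (hx : ∀ j, |x j| ≤ c) :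
    l1Dual x ≤ c := by
  refine csSup_le ⟨0, 0, by simp [l1], by simp⟩ ?_
  rintro r ⟨z, hz, rfl⟩
  exact (le_abs_self _).trans ((abs_dotProduct_le_mul_l1 hx z).trans (mul_le_of_le_one_right hc hz))

lemma dotProduct_le_l1Dual {p : ℕ} (x z : Fin p → ℝ) (hz : l1 z ≤ 1) : z ⬝ᵥ x ≤ l1Dual x := by
  refine le_csSup ⟨l1 x, ?_⟩ ⟨z, hz, rfl⟩
  rintro r ⟨z, hz, rfl⟩
  have hx : ∀ j, |x j| ≤ l1 x := fun j =>
    Finset.single_le_sum (f := fun j => |x j|) (fun i _ => abs_nonneg _) (Finset.mem_univ j)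
  exact (le_abs_self _).trans
    ((abs_dotProduct_le_mul_l1 hx z).trans (mul_le_of_le_one_right (l1_nonneg x) hz))

lemma l1Dual_nonneg {p : ℕ} (x : Fin p → ℝ) : 0 ≤ l1Dual x := by
  simpa using dotProduct_le_l1Dual x 0 (by simp [l1])

lemma abs_le_l1Dual {p : ℕ} (x : Fin p → ℝ) (j : Fin p) : |x j| ≤ l1Dual x := by
  have hl : ∀ c : ℝ, |c| = 1 → l1 (Pi.single j c) ≤ 1 := by
    intro c hc
    rw [l1, Finset.sum_eq_single j (fun i _ hi => by simp [hi]) (by simp)]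
    simp [hc]
  refine abs_le'.2 ⟨?_, ?_⟩
  · simpa using dotProduct_le_l1Dual x (Pi.single j 1) (hl 1 (by simp))
  · simpa using dotProduct_le_l1Dual x (Pi.single j (-1)) (hl (-1) (by simp))

/-! ### Noise levels -/

section Noise

variable {n p : ℕ} (X : Matrix (Fin n) (Fin p) ℝ) {ε : Fin n → ℝ}

lemma lamZero_nonneg (ε : Fin n → ℝ) : 0 ≤ lamZero X ε :=
  div_nonneg (l1Dual_nonneg _) (mul_nonneg (Nat.cast_nonneg n) (normN_nonneg ε))

lemma lamM_nonneg (ε : Fin n → ℝ) (S : Finset (Fin p)) : 0 ≤ lamM X ε S :=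
  le_max_of_le_left
    (div_nonneg (l1Dual_nonneg _) (mul_nonneg (Nat.cast_nonneg n) (normN_nonneg ε)))

lemma lamM_le (hn : 0 < n) (hε : 0 < normN ε) {lam : ℝ} (hlam : 0 ≤ lam)
    (h : ∀ j, |(ε ᵥ* X) j| ≤ lam * (n * normN ε)) (W : Finset (Fin p)) : lamM X ε W ≤ lam := by
  have hpos : 0 < n * normN ε := by positivity
  have key : ∀ V : Finset (Fin p), lamOn X ε V ≤ lam := by
    intro V
    rw [lamOn, div_le_iff₀ hpos]
    refine l1Dual_le (by positivity) fun j => ?_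
    by_cases hj : j ∈ V
    · simpa [restr, hj] using h j
    · simpa [restr, hj] using mul_nonneg hlam hpos.le
  exact max_le (key W) (key Wᶜ)

lemma abs_vecMul_le_lamM (hn : 0 < n) (hε : 0 < normN ε) (S : Finset (Fin p)) (j : Fin p) :
    |(ε ᵥ* X) j| ≤ lamM X ε S * (n * normN ε) := by
  have hpos : 0 < n * normN ε := by positivity
  have key : ∀ V : Finset (Fin p), j ∈ V → |(ε ᵥ* X) j| ≤ lamOn X ε V * (n * normN ε) := by
    intro V hj
    rw [lamOn, div_mul_cancel₀ _ hpos.ne']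
    simpa [restr, hj] using abs_le_l1Dual (restr V (ε ᵥ* X)) j
  by_cases hj : j ∈ S
  · exact (key S hj).trans (mul_le_mul_of_nonneg_right (le_max_left _ _) hpos.le)
  · exact (key Sᶜ (by simpa using hj)).trans
      (mul_le_mul_of_nonneg_right (le_max_right _ _) hpos.le)

lemma lamZero_le_lamM (hn : 0 < n) (hε : 0 < normN ε) (S : Finset (Fin p)) :
    lamZero X ε ≤ lamM X ε S := by
  have hpos : 0 < n * normN ε := by positivity
  rw [lamZero, div_le_iff₀ hpos]
  exact l1Dual_le (mul_nonneg (lamM_nonneg X ε S) hpos.le) (abs_vecMul_le_lamM X hn hε S)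

lemma dotProduct_mulVec_div_le (hn : 0 < n) {c : ℝ}
    (h : ∀ j, |(ε ᵥ* X) j| ≤ c * (n * normN ε)) (z : Fin p → ℝ) :
    ε ⬝ᵥ (X *ᵥ z) / n ≤ c * normN ε * l1 z := by
  have hn' : (0 : ℝ) < n := by exact_mod_cast hn
  rw [div_le_iff₀ hn', dotProduct_mulVec, dotProduct_comm]
  refine (le_abs_self _).trans ((abs_dotProduct_le_mul_l1 h z).trans_eq ?_)
  ring

lemma abs_vecMul_le_lamZero (hn : 0 < n) (hε : 0 < normN ε) (j : Fin p) :
    |(ε ᵥ* X) j| ≤ lamZero X ε * (n * normN ε) := by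
  rw [lamZero, div_mul_cancel₀ _ (by positivity)]
  exact abs_le_l1Dual _ j

end Noise

/-! ### Optimality and bounds on the residual -/

lemma normN_sub_smul_sq {n : ℕ} (r v : Fin n → ℝ) (s : ℝ) :
    normN (r - s • v) ^ 2 = normN r ^ 2 - 2 * s * (r ⬝ᵥ v / n) + s ^ 2 * normN v ^ 2 := by
  simp only [normN_sq_eq_dotProduct, sub_dotProduct, dotProduct_sub, smul_dotProduct,
    dotProduct_smul, smul_eq_mul, dotProduct_comm v r]
  ring

/-- First-order optimality of the square root LASSO. -/
lemma IsSqrtLasso.dotProduct_le {n p : ℕ} {X : Matrix (Fin n) (Fin p) ℝ} {Y : Fin n → ℝ}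
    {lam : ℝ} {b : Fin p → ℝ} (h : IsSqrtLasso X Y lam b) (hlam : 0 ≤ lam)
    (hpos : 0 < normN (Y - X *ᵥ b)) (β : Fin p → ℝ) :
    (Y - X *ᵥ b) ⬝ᵥ (X *ᵥ (β - b)) / n ≤ lam * (l1 β - l1 b) * normN (Y - X *ᵥ b) := by
  set r := Y - X *ᵥ b with hr
  set v := X *ᵥ (β - b) with hv
  set D := lam * (l1 β - l1 b) with hD
  have hlim : Filter.Tendsto (fun s : ℝ => D * normN r + s * ((normN v ^ 2 - D ^ 2) / 2))
      (nhdsWithin 0 (Set.Ioi 0)) (nhds (D * normN r)) := by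
    have : Continuous fun s : ℝ => D * normN r + s * ((normN v ^ 2 - D ^ 2) / 2) := by fun_prop
    simpa using (this.tendsto 0).mono_left nhdsWithin_le_nhds
  refine ge_of_tendsto hlim ?_
  -- For s below this threshold ‖r‖ₙ - sD is nonnegative, so the minimality inequality may be
  -- squared; dividing by s and letting s → 0⁺ gives the claim.
  have hs1 : 0 < normN r / (|D| + 1) := by positivity
  filter_upwards [Ioo_mem_nhdsGT (zero_lt_one' ℝ), Ioo_mem_nhdsGT hs1] with s hs hs'
  have hmin := h (b + s • (β - b))
  have hconv : l1 (b + s • (β - b)) ≤ (1 - s) * l1 b + s * l1 β := by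
    rw [l1, l1, l1, Finset.mul_sum, Finset.mul_sum, ← Finset.sum_add_distrib]
    refine Finset.sum_le_sum fun j _ => ?_
    have e : (b + s • (β - b)) j = (1 - s) * b j + s * β j := by simp; ring
    rw [e]
    refine (abs_add_le _ _).trans_eq ?_
    rw [abs_mul, abs_mul, abs_of_pos hs.1, abs_of_pos (sub_pos.2 hs.2)]
  have hres : Y - X *ᵥ (b + s • (β - b)) = r - s • v := by
    rw [mulVec_add, mulVec_smul, hr, hv]
    abel
  rw [hres, ← hr] at hmin
  have h1 : normN r - s * D ≤ normN (r - s • v) := by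
    have := mul_le_mul_of_nonneg_left hconv hlam
    rw [hD]
    linarith
  have h2 : 0 ≤ normN r - s * D := by
    have h3 := (lt_div_iff₀ (by positivity : 0 < |D| + 1)).1 hs'.2
    nlinarith [le_abs_self D, hs.1, mul_le_mul_of_nonneg_left (le_abs_self D) hs.1.le]
  have h4 := pow_le_pow_left₀ h2 h1 2
  rw [normN_sub_smul_sq] at h4
  have h5 : s * (r ⬝ᵥ v / n) ≤ s * (D * normN r + s * ((normN v ^ 2 - D ^ 2) / 2)) := by
    linarith
  exact le_of_mul_le_mul_left h5 hs.1

section Residual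

variable {n p : ℕ} {X : Matrix (Fin n) (Fin p) ℝ} {β₀ b : Fin p → ℝ} {ε : Fin n → ℝ} {lam : ℝ}

lemma f_nonneg (hlam : 0 ≤ lam) (β₀ : Fin p → ℝ) (ε : Fin n → ℝ) : 0 ≤ f lam β₀ ε :=
  div_nonneg (mul_nonneg hlam (l1_nonneg _)) (normN_nonneg _)

lemma residual_eq (X : Matrix (Fin n) (Fin p) ℝ) (β₀ b : Fin p → ℝ) (ε : Fin n → ℝ) :
    X *ᵥ β₀ + ε - X *ᵥ b = ε - X *ᵥ (b - β₀) := by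
  rw [mulVec_sub]
  abel

lemma IsSqrtLasso.normN_add_le (h : IsSqrtLasso X (X *ᵥ β₀ + ε) lam b) (hε : 0 < normN ε) :
    normN (ε - X *ᵥ (b - β₀)) + lam * l1 b ≤ normN ε * (1 + f lam β₀ ε) := by
  have h0 := h β₀
  rw [residual_eq, residual_eq, sub_self, mulVec_zero, sub_zero] at h0
  refine h0.trans_eq ?_
  rw [f]
  field_simp

/-- Comparison with β⁰ gives lam ‖b‖₁ ≤ ‖ε‖ₙ(1 + f), so lam ‖b - β⁰‖₁ ≤ ‖ε‖ₙ(1 + 2f); duality does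
the rest. -/
lemma IsSqrtLasso.dotProduct_noise_le (h : IsSqrtLasso X (X *ᵥ β₀ + ε) lam b) (hn : 0 < n)
    (hε : 0 < normN ε) (hlam : 0 < lam) :
    ε ⬝ᵥ (X *ᵥ (b - β₀)) / n ≤
      normN ε ^ 2 * (lamZero X ε / lam * (1 + 2 * f lam β₀ ε)) := by
  have h1 := h.normN_add_le hε
  have h2 := dotProduct_mulVec_div_le X hn (abs_vecMul_le_lamZero X hn hε) (b - β₀)
  have h3 : l1 (b - β₀) ≤ normN ε / lam * (1 + 2 * f lam β₀ ε) := by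
    have hf : lam * l1 β₀ = normN ε * f lam β₀ ε := by rw [f]; field_simp
    have h4 : lam * l1 (b - β₀) ≤ normN ε * (1 + 2 * f lam β₀ ε) := by
      have := mul_le_mul_of_nonneg_left (l1_sub_le b β₀) hlam.le
      have := normN_nonneg (ε - X *ᵥ (b - β₀))
      linarith
    rw [div_mul_eq_mul_div, le_div_iff₀ hlam, mul_comm]
    exact h4
  refine h2.trans ((mul_le_mul_of_nonneg_left h3
    (mul_nonneg (lamZero_nonneg X ε) hε.le)).trans_eq ?_)
  ring

/-- Cauchy–Schwarz for ε and the residual, with the noise term bounded as above. -/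
lemma IsSqrtLasso.mul_le_normN_residual (h : IsSqrtLasso X (X *ᵥ β₀ + ε) lam b) (hn : 0 < n)
    (hε : 0 < normN ε) (hlam : 0 < lam) :
    normN ε * (1 - lamZero X ε / lam * (1 + 2 * f lam β₀ ε)) ≤ normN (ε - X *ᵥ (b - β₀)) := by
  have h1 := h.dotProduct_noise_le hn hε hlam
  have h2 := dotProduct_div_le_normN_mul ε (ε - X *ᵥ (b - β₀))
  rw [dotProduct_sub, sub_div, ← normN_sq_eq_dotProduct] at h2
  refine le_of_mul_le_mul_left ?_ hε
  linarith

/-- Expand the square and drop the prediction error. This is the source of the square root in `C₂`.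
-/
lemma IsSqrtLasso.sq_mul_le_normN_residual_sq (h : IsSqrtLasso X (X *ᵥ β₀ + ε) lam b)
    (hn : 0 < n) (hε : 0 < normN ε) (hlam : 0 < lam) :
    normN ε ^ 2 * (1 - 2 * (lamZero X ε / lam) * (1 + 2 * f lam β₀ ε)) ≤
      normN (ε - X *ᵥ (b - β₀)) ^ 2 := by
  have h1 := h.dotProduct_noise_le hn hε hlam
  have h2 := normN_sub_smul_sq ε (X *ᵥ (b - β₀)) 1
  rw [one_smul] at h2
  rw [h2]
  nlinarith [sq_nonneg (normN (X *ᵥ (b - β₀)))]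

end Residual

/-! ### Effective sparsity -/

/-- This is 2xy - y² ≤ x² with x = KA/V and y = V. If V = 0 then d = 0 and the right side is ∞. -/
lemma ofReal_le_ofReal_sq_mul_inv_sq {K A V : ℝ} (hK : 0 < K) (hA : 0 < A) (hV : 0 ≤ V)
    {d : ℝ≥0∞} (hd : d ≤ ENNReal.ofReal (V / A)) :
    ENNReal.ofReal (2 * (K * A) - V ^ 2) ≤ ENNReal.ofReal (K ^ 2) * (d ^ 2)⁻¹ := by
  rcases hV.eq_or_lt with rfl | hV
  · have : d = 0 := by simpa using hd
    have hK2 : ENNReal.ofReal (K ^ 2) ≠ 0 := (ENNReal.ofReal_pos.2 (pow_pos hK 2)).ne'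
    have hd2 : (d ^ 2)⁻¹ = ⊤ := by simp [this]
    rw [hd2, ENNReal.mul_top hK2]
    exact le_top
  · have h1 : ENNReal.ofReal (((V / A) ^ 2)⁻¹) ≤ (d ^ 2)⁻¹ := by
      rw [ENNReal.ofReal_inv_of_pos (by positivity), ENNReal.inv_le_inv,
        ENNReal.ofReal_pow (by positivity)]
      gcongr
    refine le_trans ?_ (mul_le_mul_right h1 _)
    rw [← ENNReal.ofReal_mul (by positivity)]
    refine ENNReal.ofReal_le_ofReal ?_
    have h2 : K ^ 2 * ((V / A) ^ 2)⁻¹ = (K * A / V) ^ 2 := by field_simp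
    have h3 : K * A / V * V = K * A := by field_simp
    rw [h2]
    nlinarith [sq_nonneg (K * A / V - V)]

/-- Rescale z to ‖z_S‖₁ = 1 and flip the sign off S, to match the minus sign in the definition. -/
lemma eigenvalue_le {n p : ℕ} (X : Matrix (Fin n) (Fin p) ℝ) {L : ℝ} {S : Finset (Fin p)}
    (z : Fin p → ℝ) (hA : 0 < l1 (restr S z)) (hL : l1 (restr Sᶜ z) ≤ L * l1 (restr S z)) :
    eigenvalue X L S ≤ ENNReal.ofReal (normN (X *ᵥ z) / l1 (restr S z)) := by
  set A := l1 (restr S z) with hAdef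
  set β : Fin p → ℝ := A⁻¹ • (restr S z - restr Sᶜ z) with hβ
  have h1 : restr S β = A⁻¹ • restr S z := by
    ext j
    by_cases hj : j ∈ S <;> simp [hβ, restr, hj]
  have h2 : restr Sᶜ β = (-A⁻¹) • restr Sᶜ z := by
    ext j
    by_cases hj : j ∈ S <;> simp [hβ, restr, hj]
  have h3 : restr S z + restr Sᶜ z = z := by
    ext j
    by_cases hj : j ∈ S <;> simp [restr, hj]
  have h4 : X *ᵥ restr S β - X *ᵥ restr Sᶜ β = A⁻¹ • (X *ᵥ z) := by
    rw [h1, h2, mulVec_smul, mulVec_smul, neg_smul, sub_neg_eq_add, ← smul_add, ← mulVec_add, h3]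
  refine (iInf₂_le_of_le β ?_ (iInf_le _ ?_)).trans_eq ?_
  · rw [h1, l1_smul, abs_of_pos (inv_pos.2 hA), ← hAdef, inv_mul_cancel₀ hA.ne']
  · rw [h2, l1_smul, abs_neg, abs_of_pos (inv_pos.2 hA), inv_mul_le_iff₀ hA, mul_comm]
    exact hL
  · rw [h4, normN_smul, abs_of_pos (inv_pos.2 hA), inv_mul_eq_div]

/-! ### The deterministic oracle inequality -/

section Deterministic

variable {n p : ℕ} {X : Matrix (Fin n) (Fin p) ℝ} {β₀ b β : Fin p → ℝ} {ε : Fin n → ℝ}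
  {lam δ C : ℝ} {S : Finset (Fin p)}

/-- Clearing denominators, both sides say 3C(φ + 1) < 1. With `le_lamStar` this is what makes λ* >
λᵐ. -/
lemma lt_of_lt_one_div_three_mul {φ C : ℝ} (hφ : 0 ≤ φ) (hC : C < 1 / (3 * (φ + 1))) :
    C < (1 - C * (1 + 2 * φ)) / (φ + 2) := by
  rw [lt_div_iff₀ (by positivity)] at hC ⊢
  linarith

lemma le_lamStar (hn : 0 < n) (hε : 0 < normN ε) (hlam : 0 < lam)
    (hm : lamM X ε S ≤ C * lam) :
    lam * ((1 - C * (1 + 2 * f lam β₀ ε)) / (f lam β₀ ε + 2)) ≤ lamStar X β₀ ε lam := by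
  have hf := f_nonneg hlam.le β₀ ε
  have h0 : lamZero X ε / lam ≤ C := by
    rw [div_le_iff₀ hlam]
    exact (lamZero_le_lamM X hn hε S).trans hm
  rw [lamStar]
  gcongr

/-- Comparison of the `ℓ₁`-norms of a vector supported in `S` and another vector. -/
lemma l1_sub_l1_le (hβ : ∀ j, β j ≠ 0 → j ∈ S) :
    l1 β - l1 b ≤ l1 (restr S (b - β)) - l1 (restr Sᶜ (b - β)) := by
  rw [l1, l1, l1, l1, ← Finset.sum_sub_distrib, ← Finset.sum_sub_distrib]
  refine Finset.sum_le_sum fun j _ => ?_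
  by_cases hj : j ∈ S
  · simp only [restr, hj, Finset.mem_compl, not_true_eq_false, if_true, if_false, Pi.sub_apply,
      abs_zero, sub_zero]
    rw [abs_sub_comm]
    exact abs_sub_abs_le_abs_sub _ _
  · have h0 : β j = 0 := by
      by_contra h
      exact hj (hβ j h)
    simp [restr, hj, h0]

/-- The oracle inequality for the square root LASSO, on the event that the noise is nonzero. -/
theorem IsSqrtLasso.oracle_inequality (h : IsSqrtLasso X (X *ᵥ β₀ + ε) lam b) (hn : 0 < n)
    (hε : 0 < normN ε) (hlam : 0 < lam) (hδ0 : 0 ≤ δ) (hδ1 : δ < 1)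
    (hβ : ∀ j, β j ≠ 0 → j ∈ S) (hm : lamM X ε S ≤ C * lam)
    (hC : C < 1 / (3 * (f lam β₀ ε + 1)))
    {g : ℝ} (hg : normN ε * (g + C) ≤ normN (ε - X *ᵥ (b - β₀))) :
    ENNReal.ofReal (normN (X *ᵥ (b - β₀)) ^ 2 +
        2 * δ * normN ε * (lam * g) * l1 (b - β)) ≤
      ENNReal.ofReal (normN (X *ᵥ (β - β₀)) ^ 2) +
        ENNReal.ofReal (C₁ β₀ ε lam δ C * lam ^ 2) * effSparsity X (LS X β₀ ε lam δ S) S := by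
  have hf := f_nonneg hlam.le β₀ ε
  have hm0 := lamM_nonneg X ε S
  have hC0 : 0 ≤ C := by
    by_contra hneg
    nlinarith
  have hgap := lt_of_lt_one_div_three_mul hf hC
  have hstar := le_lamStar (β₀ := β₀) hn hε hlam hm
  have hres_ub := h.normN_add_le hε
  have hres_lb := h.mul_le_normN_residual hn hε hlam
  have hb := l1_nonneg b
  set e := normN ε with he
  set φ := f lam β₀ ε with hφ
  set N := normN (ε - X *ᵥ (b - β₀)) with hN
  set μ := lamM X ε S with hμ
  set lstar := lamStar X β₀ ε lam with hlstar
  set A := l1 (restr S (b - β)) with hA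
  set B := l1 (restr Sᶜ (b - β)) with hB
  have hA0 : 0 ≤ A := l1_nonneg _
  have hB0 : 0 ≤ B := l1_nonneg _
  have hAB : A + B = l1 (b - β) := l1_restr_add_l1_restr_compl _ _
  have hCpos : C * lam < lstar := by
    refine lt_of_lt_of_le ?_ hstar
    rw [mul_comm]
    exact mul_lt_mul_of_pos_left hgap hlam
  -- The denominator f + 2 ≥ 1 only decreases λ*, so the lower bound on the residual yields e λ* ≤
  -- lam N.
  have hstar_res : e * lstar ≤ lam * N := by
    have h1 : lstar ≤ lam * (1 - lamZero X ε / lam * (1 + 2 * φ)) := by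
      have hpos : 0 < lstar := lt_of_le_of_lt (by positivity) hCpos
      have hpos' : 0 ≤ 1 - lamZero X ε / lam * (1 + 2 * φ) := by
        by_contra hneg
        have : lstar ≤ 0 := mul_nonpos_of_nonneg_of_nonpos hlam.le
          (div_nonpos_of_nonpos_of_nonneg (not_le.1 hneg).le (by positivity))
        linarith
      rw [hlstar, lamStar]
      exact mul_le_mul_of_nonneg_left (div_le_self hpos' (by linarith)) hlam.le
    calc e * lstar ≤ e * (lam * (1 - lamZero X ε / lam * (1 + 2 * φ))) := by gcongr
      _ = lam * (e * (1 - lamZero X ε / lam * (1 + 2 * φ))) := by ring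
      _ ≤ lam * N := by gcongr
  have hNpos : 0 < N := by
    have : 0 < e * lstar := mul_pos hε (lt_of_le_of_lt (by positivity) hCpos)
    exact pos_of_mul_pos_right (this.trans_le hstar_res) hlam.le
  have hNub : N ≤ e * (1 + φ) := by linarith [mul_nonneg hlam.le hb]
  have hopt := h.dotProduct_le hlam.le (by rw [residual_eq]; exact hNpos) β
  rw [residual_eq, ← hN] at hopt
  have hnoise := dotProduct_mulVec_div_le X hn (abs_vecMul_le_lamM X hn hε S) (b - β)
  rw [← hμ, ← he, ← hAB] at hnoise
  have hl1 := l1_sub_l1_le (b := b) hβ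
  rw [← hA, ← hB] at hl1
  set u := X *ᵥ (b - β₀) with hu
  set w := X *ᵥ (b - β) with hw
  set I := u ⬝ᵥ w / n with hI
  have hneg : X *ᵥ (β - b) = -w := by rw [hw, ← mulVec_neg, neg_sub]
  have hoptI : I ≤ ε ⬝ᵥ w / n + lam * (l1 β - l1 b) * N := by
    rw [hneg, dotProduct_neg, sub_dotProduct, neg_div, sub_div] at hopt
    linarith
  have hpolar : normN (X *ᵥ (β - β₀)) ^ 2 = normN u ^ 2 - 2 * I + normN w ^ 2 := by
    have h1 : X *ᵥ (β - β₀) = u - (1 : ℝ) • w := by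
      rw [one_smul, hu, hw, ← mulVec_sub]
      congr 1
      abel
    rw [h1, normN_sub_smul_sq]
    ring
  -- κe and ρ are the net weights on S and off S: the noise adds μe to the penalty weight on S and
  -- removes it off S.
  obtain ⟨κ, hκ⟩ : ∃ κ, κ = lam * (1 + φ) + μ := ⟨_, rfl⟩
  obtain ⟨ρ, hρ⟩ : ∃ ρ, ρ = lam * N - μ * e := ⟨_, rfl⟩
  have hκ0 : 0 < κ := by rw [hκ]; positivity
  have hlamN : lam * N ≤ lam * (e * (1 + φ)) := mul_le_mul_of_nonneg_left hNub hlam.le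
  have hbasic : I + ρ * B ≤ κ * e * A := by
    have h1 : lam * (l1 β - l1 b) * N ≤ lam * (A - B) * N := by gcongr
    have h2 : lam * N * A ≤ lam * (e * (1 + φ)) * A := mul_le_mul_of_nonneg_right hlamN hA0
    rw [hκ, hρ]
    linarith
  have hρg : e * (lam * g) ≤ ρ := by
    have h1 := mul_le_mul_of_nonneg_left hg hlam.le
    have h2 := mul_le_mul_of_nonneg_left hm hε.le
    rw [hρ]
    linarith
  have hρκ : ρ ≤ κ * e := by
    rw [hρ, hκ]
    linarith [mul_nonneg hm0 hε.le]
  have hρstar : e * (lstar - μ) ≤ ρ := by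
    rw [hρ]
    linarith
  have hsep : 0 < lstar - μ := by linarith
  -- Both weights dominate e lam g, so the δ-slack controls the whole ℓ₁-norm of b - β.
  have hgAB : 2 * δ * e * (lam * g) * l1 (b - β) ≤ 2 * δ * (κ * e * A + ρ * B) := by
    have h1 : e * (lam * g) * A ≤ κ * e * A := mul_le_mul_of_nonneg_right (hρg.trans hρκ) hA0
    have h2 : e * (lam * g) * B ≤ ρ * B := mul_le_mul_of_nonneg_right hρg hB0
    have h3 := mul_le_mul_of_nonneg_left (add_le_add h1 h2) hδ0
    rw [← hAB]
    linarith
  -- If I is below the negative slack, expanding the square suffices; otherwise `hbasic` forces the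
  -- cone condition B ≤ L_S A.
  rcases le_or_gt I (-(δ * (κ * e * A + ρ * B))) with hcase | hcase
  · refine (ENNReal.ofReal_le_ofReal ?_).trans le_self_add
    rw [hpolar]
    linarith [sq_nonneg (normN w)]
  · have hcone : (1 - δ) * (ρ * B) < (1 + δ) * (κ * e * A) := by linarith
    have hρ0 : 0 < ρ := (mul_pos hε hsep).trans_le hρstar
    have h1δ : 0 < 1 - δ := by linarith
    have hApos : 0 < A := by
      rcases hA0.eq_or_lt with h0 | h0
      · rw [← h0] at hcone
        have := mul_nonneg h1δ.le (mul_nonneg hρ0.le hB0)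
        linarith
      · exact h0
    have hBL : B ≤ LS X β₀ ε lam δ S * A := by
      have h1 : (1 - δ) * (e * (lstar - μ) * B) ≤ (1 + δ) * (κ * e * A) :=
        le_trans (by gcongr) hcone.le
      have h2 : (1 - δ) * ((lstar - μ) * B) ≤ (1 + δ) * (κ * A) :=
        le_of_mul_le_mul_left (by linarith) hε
      have h3 : LS X β₀ ε lam δ S * A = (1 + δ) * (κ * A) / ((1 - δ) * (lstar - μ)) := by
        rw [LS, lamTilde, ← hφ, ← hμ, ← hlstar, ← hκ]
        field_simp
      rw [h3, le_div_iff₀ (by positivity)]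
      linarith
    have heig := eigenvalue_le X (b - β) hApos hBL
    have hKpos : 0 < (1 + δ) * e * (lam * (φ + C + 1)) := by positivity
    have hbound := ofReal_le_ofReal_sq_mul_inv_sq hKpos hApos (normN_nonneg w) heig
    have hC₁ : C₁ β₀ ε lam δ C * lam ^ 2 = ((1 + δ) * e * (lam * (φ + C + 1))) ^ 2 := by
      rw [C₁]
      ring
    rw [hC₁, effSparsity]
    refine le_trans ?_ (add_le_add le_rfl hbound)
    refine (ENNReal.ofReal_le_ofReal ?_).trans ENNReal.ofReal_add_le
    have hκC : κ ≤ lam * (φ + C + 1) := by rw [hκ]; linarith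
    have h1 : (1 + δ) * e * κ * A ≤ (1 + δ) * e * (lam * (φ + C + 1)) * A := by gcongr
    have h2 : 0 ≤ (1 - δ) * (ρ * B) := by positivity
    rw [hpolar]
    linarith

/-- The `ℓ₁`-estimation bound that follows from a lower bound `e (g + C)` on the residual. -/
theorem IsSqrtLasso.estimationBound (h : IsSqrtLasso X (X *ᵥ β₀ + ε) lam b) (hn : 0 < n)
    (hε : 0 < normN ε) (hlam : 0 < lam) (hδ0 : 0 < δ) (hδ1 : δ < 1)
    (hβ : ∀ j, β j ≠ 0 → j ∈ S) (hm : lamM X ε S ≤ C * lam)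
    (hC : C < 1 / (3 * (f lam β₀ ε + 1)))
    {g : ℝ} (hg0 : 0 < g) (hg : normN ε * (g + C) ≤ normN (ε - X *ᵥ (b - β₀))) :
    EstimationBound X β₀ ε lam δ C (1 / (2 * δ * normN ε) * (1 / g)) b β S := by
  have hmain := h.oracle_inequality hn hε hlam hδ0.le hδ1 hβ hm hC hg
  obtain ⟨k, hk⟩ : ∃ k, k = 1 / (2 * δ * normN ε) * (1 / g) := ⟨_, rfl⟩
  have hk0 : 0 < k := by rw [hk]; positivity
  rw [EstimationBound, ← hk]
  have e1 : ENNReal.ofReal k * (ENNReal.ofReal (normN (X *ᵥ (β - β₀)) ^ 2 / lam) +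
      ENNReal.ofReal (C₁ β₀ ε lam δ C * lam) * effSparsity X (LS X β₀ ε lam δ S) S) =
      ENNReal.ofReal (k / lam) * (ENNReal.ofReal (normN (X *ᵥ (β - β₀)) ^ 2) +
        ENNReal.ofReal (C₁ β₀ ε lam δ C * lam ^ 2) * effSparsity X (LS X β₀ ε lam δ S) S) := by
    rw [mul_add, mul_add, ← mul_assoc, ← mul_assoc, ← ENNReal.ofReal_mul hk0.le,
      ← ENNReal.ofReal_mul hk0.le, ← ENNReal.ofReal_mul (by positivity),
      ← ENNReal.ofReal_mul (by positivity)]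
    congr 2
    · ring_nf
    · congr 1
      field_simp
  rw [e1]
  refine le_trans ?_ (mul_le_mul_right hmain _)
  rw [← ENNReal.ofReal_mul (by positivity)]
  refine ENNReal.ofReal_le_ofReal ?_
  have e2 : k / lam * (2 * δ * normN ε * (lam * g) * l1 (b - β)) = l1 (b - β) := by
    rw [hk]
    field_simp
  rw [mul_add, e2]
  exact le_add_of_nonneg_left (by positivity)

end Deterministic

end SqrtLasso

/-! ### Conclusion -/

theorem corollary3 {Ω : Type*} [MeasurableSpace Ω] (P : Measure Ω) [IsProbabilityMeasure P]
    {n p : ℕ} (hn : 0 < n)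
    (X : Matrix (Fin n) (Fin p) ℝ) (hX : ∀ j, (Xᵀ * X) j j / (n : ℝ) = 1)
    (β₀ : Fin p → ℝ)
    (σ : ℝ≥0) (hσ : 0 < σ)
    (ε : Ω → Fin n → ℝ)
    (hindep : iIndepFun (fun (i : Fin n) (ω : Ω) => ε ω i) P)
    (hlaw : ∀ i, HasLaw (fun ω => ε ω i) (gaussianReal 0 (σ ^ 2)) P)
    (α t Δ lam δ : ℝ) (hα0 : 0 < α) (hα1 : α < 1)
    (ht : t = √(Real.log (4 / α)))
    (hΔ0 : 0 < Δ) (hΔ : Δ ^ 2 = 1 - t * (2 / √(n : ℝ)))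
    (hlam : lam = √(2 / (n : ℝ)) * (t / Δ + 2 + √(Real.log (p : ℝ))))
    (hδ0 : 0 ≤ δ) (hδ1 : δ < 1) :
    ∃ A : Set Ω, MeasurableSet A ∧ ENNReal.ofReal (1 - α) ≤ P A ∧ ∀ ω ∈ A,
      (∀ W : Finset (Fin p), SqrtLasso.lamM X (ε ω) W ≤ lam) ∧
      ∀ βhat : Fin p → ℝ, SqrtLasso.IsSqrtLasso X (X *ᵥ β₀ + ε ω) lam βhat →
      ∀ (βs : Fin p → ℝ) (Ss : Finset (Fin p)), SqrtLasso.IsOracle X β₀ (ε ω) lam δ βs Ss →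
      ∀ C : ℝ, SqrtLasso.lamM X (ε ω) Ss ≤ C * lam →
        C < 1 / (3 * (SqrtLasso.f lam β₀ (ε ω) + 1)) →
        SqrtLasso.PredictionBound X β₀ (ε ω) lam δ C βhat βs Ss ∧
        (0 < δ →
          SqrtLasso.EstimationBound X β₀ (ε ω) lam δ C
            (SqrtLasso.C₂' β₀ (ε ω) lam δ C) βhat βs Ss ∧
          (C < √(1 - 2 * C * (1 + 2 * SqrtLasso.f lam β₀ (ε ω))) →
            SqrtLasso.EstimationBound X β₀ (ε ω) lam δ C
              (SqrtLasso.C₂ β₀ (ε ω) lam δ C) βhat βs Ss)) := by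
  have hn' : (0 : ℝ) < n := by exact_mod_cast hn
  have ht0 : 0 ≤ t := by rw [ht]; positivity
  have hΔ1 : Δ ≤ 1 := by
    have : 0 ≤ t * (2 / √(n : ℝ)) := by positivity
    nlinarith
  -- Dividing by Δ ≤ 1 only enlarges lam, and the tail bound already holds with t.
  have htΔ : t ≤ t / Δ := le_div_self ht0 hΔ0 hΔ1
  have hlam0 : 0 < lam := by rw [hlam]; positivity
  obtain ⟨A, hAm, hPA, hA⟩ := SqrtLasso.exists_event_abs_vecMul_le P hn X hX σ hσ ε hindep hlaw
    hα0 hα1 ht (by linarith) hlam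
  refine ⟨A, hAm, hPA, fun ω hω => ?_⟩
  obtain ⟨hε, hcol⟩ := hA ω hω
  refine ⟨SqrtLasso.lamM_le X hn hε hlam0.le hcol, ?_⟩
  intro βhat hhat βs Ss hor C hm hC
  have hf := SqrtLasso.f_nonneg hlam0.le β₀ (ε ω)
  have hC0 : 0 ≤ C := by
    have := SqrtLasso.lamM_nonneg X (ε ω) Ss
    by_contra hneg
    nlinarith
  have hx : SqrtLasso.lamZero X (ε ω) / lam ≤ C := by
    rw [div_le_iff₀ hlam0]
    exact (SqrtLasso.lamZero_le_lamM X hn hε Ss).trans hm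
  have hgap := SqrtLasso.lt_of_lt_one_div_three_mul hf hC
  have hres := hhat.mul_le_normN_residual hn hε hlam0
  have hres2 := hhat.sq_mul_le_normN_residual_sq hn hε hlam0
  set φ := SqrtLasso.f lam β₀ (ε ω) with hφ
  -- The residual bound in the form e(g + C), with g the denominator in `C₂'`; `C₂` comes from g =
  -- √(1 - 2C(1 + 2φ)) - C.
  have hlow : SqrtLasso.normN (ε ω) * ((1 - C * (1 + 2 * φ)) / (φ + 2) - C + C) ≤
      SqrtLasso.normN (ε ω - X *ᵥ (βhat - β₀)) := by
    refine le_trans ?_ hres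
    gcongr
    have h0 : 0 ≤ 1 - C * (1 + 2 * φ) := by
      have := (lt_div_iff₀ (by positivity)).1 hgap
      nlinarith
    have h1 : (1 - C * (1 + 2 * φ)) / (φ + 2) ≤ 1 - C * (1 + 2 * φ) :=
      div_le_self h0 (by linarith)
    have h2 : SqrtLasso.lamZero X (ε ω) / lam * (1 + 2 * φ) ≤ C * (1 + 2 * φ) := by gcongr
    linarith
  refine ⟨?_, fun hδ => ⟨?_, fun hsqrt => ?_⟩⟩
  · refine le_trans (ENNReal.ofReal_le_ofReal ?_)
      (hhat.oracle_inequality hn hε hlam0 hδ0 hδ1 hor.1 hm hC hlow)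
    have h3 : 0 ≤ (1 - C * (1 + 2 * φ)) / (φ + 2) - C := by linarith
    have h4 := SqrtLasso.l1_nonneg (βhat - βs)
    exact le_add_of_nonneg_right (by positivity)
  · exact hhat.estimationBound hn hε hlam0 hδ hδ1 hor.1 hm hC (sub_pos.2 hgap) hlow
  · refine hhat.estimationBound hn hε hlam0 hδ hδ1 hor.1 hm hC (sub_pos.2 hsqrt) ?_
    rw [sub_add_cancel]
    have h5 : 0 ≤ 1 - 2 * C * (1 + 2 * φ) := (Real.sqrt_pos.1 (hC0.trans_lt hsqrt)).le
    refine (sq_le_sq₀ (by positivity) (SqrtLasso.normN_nonneg _)).1 ?_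
    rw [mul_pow, Real.sq_sqrt h5]
    refine le_trans ?_ hres2
    gcongr
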